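/- **Setting.** A base station serves two users $T$ and $R$ on the two sides of a STAR-RIS with $M$ elements. The channels $g_m$ (base station to element $m$), $h^\chi_m$ (element $m$ to user $\chi$) and $h^\chi_d$ (base station directly to user $\chi$), for $m=1,\dots,M$ and $\chi\in\{T,R\}$, are independent Rician fading channels: each has the form $$\sqrt{\frac{\rho}{d^{\alpha}}}\Big(\sqrt{\tfrac{K}{K+1}}\,u+\sqrt{\tfrac1{K+1}}\,w\Big),\qquad w\sim\mathcal{CN}(0,1),$$ where $\rho,d>0$, $\alpha\in\mathbb R$, $K\ge 0$, and $u\in\mathbb C$ with $|u|=1$, are constants that may depend on the link, and the variables $w$ of all links are independent. The elements have common amplitudes $\beta^R\in[0,1]$ and $\beta^T=\sqrt{1-(\beta^R)^2}$, and phases $\phi^R_m,\phi^T_m$ coupled by $\phi^R_m-\phi^T_m=\frac{\pi}{2}+\nu_m\pi$ with $\nu_m\in\{0,1\}$. The end-to-end channel of user $\chi$ is $$H^\chi=\sum_{m=1}^M g_mh^\chi_m\beta^\chi e^{j\phi^\chi_m}+h^\chi_d .$$ One user $p\in\{T,R\}$ with $\beta^p>0$ is the primary user. In the primary-secondary phase-shift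 configuration (PS-PSC), for almost every channel realization the phases $\phi^p_1,\dots,\phi^p_M$ maximize $|H^p|^2$ over $[0,2\pi)^M$. The bits $\nu_m$ are then chosen so as to favour the other user; the result below holds for every choice of the bits. **Outage.** Let $P_{BS}$ be the transmit power, $\sigma_0^2>0$ the noise variance, $c_T,c_R>0$ the power allocation coefficients and $\tilde R_T,\tilde R_R>0$ the target rates. Under OMA, user $\chi$ is in outage if $$\tfrac12\log_2\Big(1+\frac{P_{BS}c_\chi^2|H^\chi|^2}{\sigma_0^2/2}\Big)<\tilde R_\chi .$$ Under NOMA, let $s$ be the user that performs successive interference cancellation, and let $w$ be the other user. User $w$ is in outage if $$\log_2\Big(1+\frac{P_{BS}c_w^2|H^w|^2}{P_{BS}c_s^2|H^w|^2+\sigma_0^2}\Big)<\tilde R_w .$$ User $s$ is in outage if $$\log_2\Big(1+\frac{P_{BS}c_w^2|H^s|^2}{P_{BS}c_s^2|H^s|^2+\sigma_0^2}\Big)<\tilde R_w\quad\text{or}\quad \log_2\Big(1+\frac{P_{BS}c_s^2|H^s|^2}{\sigma_0^2}\Big)<\tilde R_s .$$ For NOMA assume that $c_w^2>(2^{\tilde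 R_w}-1)c_s^2$. Let $P_{out}(P_{BS})$ denote the probability that the primary user is in outage. **Corollary 1 (diversity of the primary user).** For the PS-PSC strategy, the diversity order of the primary user $p$ is the same for OMA and for NOMA (with either user performing successive interference cancellation): $$-\lim_{P_{BS}\to\infty}\frac{\log P_{out}(P_{BS})}{\log P_{BS}}=M+1 .$$ -/

import Mathlib

open Filter Topology MeasureTheory ProbabilityTheory

namespace StarRis

/-- The two users: `T` on the transmission side and `R` on the reflection side of the surface. -/
inductive User : Type
  | T : User
  | R : User

/-- The user on the opposite side of the surface. -/
def User.other : User → User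
  | .T => .R
  | .R => .T

/-- The propagation links of a surface with `M` elements: base station to element `m`,
element `m` to user `χ`, and the direct link from the base station to user `χ`. -/
inductive Link (M : ℕ) : Type
  | bsToElement (m : Fin M) : Link M
  | elementToUser (χ : User) (m : Fin M) : Link M
  | direct (χ : User) : Link M

/-- The deterministic parameters of a Rician link: path loss at the reference distance, length,
path loss exponent, (linear) Rician factor and the unit-modulus line-of-sight component. -/
structure RicianLink where
  refLoss : ℝ
  dist : ℝ
  exponent : ℝ
  factor : ℝ
  los : ℂ
  refLoss_pos : 0 < refLoss
  dist_pos : 0 < dist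
  factor_nonneg : 0 ≤ factor
  norm_los : ‖los‖ = 1

/-- The channel coefficient of a Rician link when the non-line-of-sight component equals `w`. -/
noncomputable def RicianLink.coeff (L : RicianLink) (w : ℂ) : ℂ :=
  (Real.sqrt (L.refLoss / L.dist ^ L.exponent) : ℂ) *
    ((Real.sqrt (L.factor / (L.factor + 1)) : ℂ) * L.los +
      (Real.sqrt (1 / (L.factor + 1)) : ℂ) * w)

/-- The circularly symmetric complex Gaussian law with `E|w|² = 1`, i.e. independent real and
imaginary parts with law `N(0, 1/2)`; the modulus is Rayleigh distributed. -/
noncomputable def stdComplexGaussian : Measure ℂ :=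
  ((gaussianReal 0 (1 / 2)).prod (gaussianReal 0 (1 / 2))).map Complex.measurableEquivRealProd.symm

/-- The end-to-end channel `∑ g_m h_m β_m e^{jφ_m} + h_d` of user `χ`, for the realization `c` of
all link coefficients, the common element amplitude `b` and the element phases `φ`. -/
noncomputable def endToEnd {M : ℕ} (c : Link M → ℂ) (χ : User) (b : ℝ) (φ : Fin M → ℝ) : ℂ :=
  (∑ m : Fin M, c (.bsToElement m) * c (.elementToUser χ m) * (b : ℂ) *
      Complex.exp (Complex.I * (φ m : ℂ))) + c (.direct χ)

/-- The correlated phase-shift model: `φ^R_m - φ^T_m = π/2 + ν_m π` with auxiliary bits `ν_m`. -/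
def PhaseCoupled {M : ℕ} (φ : User → Fin M → ℝ) (ν : Fin M → Fin 2) : Prop :=
  ∀ m, φ .R m - φ .T m = Real.pi / 2 + ((ν m : ℕ) : ℝ) * Real.pi

/-- First step of the primary-secondary configuration: the phases obey the correlated phase-shift
model (with some auxiliary bits), and those of the primary user `p` maximize the channel gain of `p`
over `[0, 2π)^M`. -/
structure IsPrimaryConfigured {M : ℕ} (c : Link M → ℂ) (b : User → ℝ) (p : User)
    (φ : User → Fin M → ℝ) (ν : Fin M → Fin 2) : Prop where
  coupled : PhaseCoupled φ ν
  primary_range : ∀ m, φ p m ∈ Set.Ico 0 (2 * Real.pi)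
  primary_max : ∀ ψ : Fin M → ℝ, (∀ m, ψ m ∈ Set.Ico 0 (2 * Real.pi)) →
    ‖endToEnd c p (b p) ψ‖ ^ 2 ≤ ‖endToEnd c p (b p) (φ p)‖ ^ 2

/-- The full primary-secondary phase-shift configuration: in the second step the auxiliary bits
maximize the channel gain of the other user, the primary phases being kept.  The primary user's
channel does not see this step. -/
structure IsPSPSC {M : ℕ} (c : Link M → ℂ) (b : User → ℝ) (p : User)
    (φ : User → Fin M → ℝ) (ν : Fin M → Fin 2) : Prop extends
    IsPrimaryConfigured c b p φ ν where
  secondary_max : ∀ (ψ : User → Fin M → ℝ) (ν' : Fin M → Fin 2), ψ p = φ p → PhaseCoupled ψ ν' →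
    ‖endToEnd c p.other (b p.other) (ψ p.other)‖ ^ 2 ≤
      ‖endToEnd c p.other (b p.other) (φ p.other)‖ ^ 2

/-- Multiple access parameters: power allocation coefficients `c_χ`, noise variance `σ₀²` and
target rates of the two users. -/
structure Access where
  coef : User → ℝ
  noise : ℝ
  target : User → ℝ
  coef_pos : ∀ χ, 0 < coef χ
  noise_pos : 0 < noise
  target_pos : ∀ χ, 0 < target χ

/-- The OMA rate of user `χ` with transmit power `P` and channel `H`. -/
noncomputable def Access.omaRate (A : Access) (χ : User) (P : ℝ) (H : ℂ) : ℝ :=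
  1 / 2 * Real.logb 2 (1 + P * A.coef χ ^ 2 * ‖H‖ ^ 2 / (A.noise / 2))

/-- The NOMA rate at which a user with channel `H` detects the message of the non-SIC user
`s.other`, treating the signal of the SIC user `s` as interference. -/
noncomputable def Access.nomaInterferedRate (A : Access) (s : User) (P : ℝ) (H : ℂ) : ℝ :=
  Real.logb 2 (1 + P * A.coef s.other ^ 2 * ‖H‖ ^ 2 / (P * A.coef s ^ 2 * ‖H‖ ^ 2 + A.noise))

/-- The NOMA rate at which the SIC user `s` with channel `H` detects its own message after the
interference has been removed. -/
noncomputable def Access.nomaOwnRate (A : Access) (s : User) (P : ℝ) (H : ℂ) : ℝ :=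
  Real.logb 2 (1 + P * A.coef s ^ 2 * ‖H‖ ^ 2 / A.noise)

/-- User `χ` with channel `H` is in outage under OMA. -/
def Access.omaOutage (A : Access) (χ : User) (P : ℝ) (H : ℂ) : Prop :=
  A.omaRate χ P H < A.target χ

/-- User `χ` with channel `H` is in outage under NOMA with SIC at user `s`. The SIC user is in
outage if it cannot decode the other user's message or cannot decode its own; the other user
if it cannot decode its own message directly. -/
def Access.nomaOutage (A : Access) : (s χ : User) → ℝ → ℂ → Prop
  | .R, .R, P, H => A.nomaInterferedRate .R P H < A.target .T ∨ A.nomaOwnRate .R P H < A.target .R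
  | .R, .T, P, H => A.nomaInterferedRate .R P H < A.target .T
  | .T, .T, P, H => A.nomaInterferedRate .T P H < A.target .R ∨ A.nomaOwnRate .T P H < A.target .T
  | .T, .R, P, H => A.nomaInterferedRate .T P H < A.target .R

/-- `d` is the diversity order of the outage probability `Pout`, a function of the transmit
power. -/
def HasDiversityOrder (Pout : ℝ → ℝ) (d : ℝ) : Prop :=
  Tendsto (fun P : ℝ => -(Real.log (Pout P) / Real.log P)) atTop (𝓝 d)

end StarRis

/-! Optimal phases align every reflected path with the direct one, so `|H^p|` equals the coherent
gain `G = b ∑ |g_m||h_m| + |h_d|` almost surely (`IsPrimaryConfigured.norm_endToEnd_eq`). Each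
outage event, OMA or NOMA, is a threshold event `P * ‖H‖ ^ 2 < τ`. It therefore suffices that
`Prob(G < ε)` decays like `ε ^ (2 * (M + 1))` on the logarithmic scale.

Lower bound: `G < ε` holds when every `|g_m| < 1` and each of the `M + 1` moduli `|h_m|`, `|h_d|` is
below a multiple of `ε`. By independence each small modulus costs a factor of order `ε ^ 2`, the
area of a disk.

Upper bound: `G < ε` forces `|h_d|` and all the products `|g_m||h_m|` to be of order at most `ε`. A
Gaussian coefficient has finite negative moments of every order `s < 2`, so Markov's inequality for
the product of all `|·| ^ (-s)` gives `ε ^ (s * (M + 1))`. Letting `s → 2` loses nothing on the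
logarithmic scale and avoids tracking the logarithm produced by the products `|g_m||h_m|`. -/

namespace StarRis

open scoped ENNReal NNReal

/-! ### Gaussian laws: negative moments and small balls -/

/-- A nondegenerate Gaussian law is dominated by a multiple of Lebesgue measure. -/
theorem gaussianReal_le_smul_volume (m : ℝ) {v : ℝ≥0} (hv : v ≠ 0) :
    gaussianReal m v ≤ ENNReal.ofReal (Real.sqrt (2 * Real.pi * v))⁻¹ • volume := by
  rw [gaussianReal_of_var_ne_zero _ hv, ← withDensity_const]
  refine withDensity_mono (ae_of_all _ fun x => ENNReal.ofReal_le_ofReal ?_)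
  rw [gaussianPDFReal]
  refine mul_le_of_le_one_right (by positivity) (Real.exp_le_one_iff.2 ?_)
  exact div_nonpos_of_nonpos_of_nonneg (neg_nonpos.2 (sq_nonneg _)) (by positivity)

theorem setLIntegral_Icc_enorm_rpow_neg_lt_top {t : ℝ} (ht : t < 1) :
    ∫⁻ x in Set.Icc (-1 : ℝ) 1, ‖x‖ₑ ^ (-t) < ∞ := by
  have h1 : ∫⁻ x in Set.Ioc (0 : ℝ) 1, ‖x‖ₑ ^ (-t) < ∞ := by
    have h := (intervalIntegral.intervalIntegrable_rpow' (a := 0) (b := 1)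
      (show -1 < -t by linarith)).1.2
    refine lt_of_le_of_lt (le_of_eq ?_) h
    refine setLIntegral_congr_fun measurableSet_Ioc fun x hx => ?_
    rw [Real.enorm_eq_ofReal hx.1.le, ENNReal.ofReal_rpow_of_pos hx.1,
      Real.enorm_eq_ofReal (Real.rpow_nonneg hx.1.le _)]
  have h2 : ∫⁻ x in Set.Ico (-1 : ℝ) 0, ‖x‖ₑ ^ (-t) < ∞ := by
    have hp : MeasurePreserving (fun x : ℝ => -x) volume volume := Measure.measurePreserving_neg _
    have := hp.setLIntegral_comp_preimage_emb (MeasurableEquiv.neg ℝ).measurableEmbedding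
      (fun x => ‖x‖ₑ ^ (-t)) (Set.Ioc 0 1)
    rw [← this] at h1
    simpa using h1
  have h3 : Set.Icc (-1 : ℝ) 1 = (Set.Ico (-1) 0 ∪ {0}) ∪ Set.Ioc 0 1 := by
    ext x
    simp only [Set.mem_Icc, Set.mem_union, Set.mem_Ico, Set.mem_singleton_iff, Set.mem_Ioc]
    grind
  rw [h3]
  refine (lintegral_union_le _ _ _).trans_lt (ENNReal.add_lt_top.2 ⟨?_, h1⟩)
  refine (lintegral_union_le _ _ _).trans_lt (ENNReal.add_lt_top.2 ⟨h2, ?_⟩)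
  simp

/-- Negative moments of order less than one of a nondegenerate Gaussian law are finite. -/
theorem lintegral_enorm_rpow_neg_gaussianReal_lt_top (m : ℝ) {v : ℝ≥0} (hv : v ≠ 0) {t : ℝ}
    (ht0 : 0 ≤ t) (ht : t < 1) : ∫⁻ x, ‖x‖ₑ ^ (-t) ∂gaussianReal m v < ∞ := by
  -- On `[-1, 1]` the density is bounded and `|x| ^ (-t)` is integrable; outside, the integrand is
  -- at most `1`.
  rw [← lintegral_add_compl _ (measurableSet_Icc (a := (-1 : ℝ)) (b := 1))]
  refine ENNReal.add_lt_top.2 ⟨?_, ?_⟩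
  · refine (lintegral_mono' (Measure.restrict_mono le_rfl (gaussianReal_le_smul_volume m hv))
      le_rfl).trans_lt ?_
    rw [Measure.restrict_smul, lintegral_smul_measure]
    exact ENNReal.mul_lt_top ENNReal.ofReal_lt_top (setLIntegral_Icc_enorm_rpow_neg_lt_top ht)
  · refine (setLIntegral_mono (g := fun _ => 1) measurable_const fun x hx => ?_).trans_lt
      (by simp [measure_lt_top])
    have hx1 : 1 ≤ ‖x‖ₑ := by
      rw [← enorm_one (G := ℝ), enorm_le_iff_norm_le, norm_one]
      by_contra hlt
      exact hx (abs_le.1 (not_le.1 hlt).le)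
    rw [ENNReal.rpow_neg]
    exact ENNReal.inv_le_one.2 (by simpa using ENNReal.rpow_le_rpow hx1 ht0)

theorem lintegral_enorm_sub_rpow_neg_gaussianReal_lt_top (a m : ℝ) {v : ℝ≥0} (hv : v ≠ 0) {t : ℝ}
    (ht0 : 0 ≤ t) (ht : t < 1) : ∫⁻ x, ‖x - a‖ₑ ^ (-t) ∂gaussianReal m v < ∞ := by
  have h := lintegral_enorm_rpow_neg_gaussianReal_lt_top (m - a) hv ht0 ht
  rwa [← gaussianReal_map_sub_const, lintegral_map (by fun_prop) (by fun_prop)] at h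

/-- Negative moments of order less than two of the complex Gaussian law are finite. -/
theorem lintegral_enorm_sub_rpow_neg_stdComplexGaussian_lt_top (z : ℂ) {s : ℝ}
    (hs0 : 0 ≤ s) (hs : s < 2) : ∫⁻ w, ‖w - z‖ₑ ^ (-s) ∂stdComplexGaussian < ∞ := by
  have hv : (1 / 2 : ℝ≥0) ≠ 0 := by norm_num
  rw [stdComplexGaussian, lintegral_map_equiv]
  -- Splitting the exponent evenly over the two coordinates makes the bound factor under the product
  -- law, with orders `s / 2 < 1`.
  have key : ∀ p : ℝ × ℝ, ‖Complex.measurableEquivRealProd.symm p - z‖ₑ ^ (-s) ≤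
      ‖p.1 - z.re‖ₑ ^ (-(s / 2)) * ‖p.2 - z.im‖ₑ ^ (-(s / 2)) := fun p => by
    set w := Complex.measurableEquivRealProd.symm p with hw
    have h1 : ‖p.1 - z.re‖ₑ ≤ ‖w - z‖ₑ := by
      rw [enorm_le_iff_norm_le]
      exact Complex.abs_re_le_norm (w - z)
    have h2 : ‖p.2 - z.im‖ₑ ≤ ‖w - z‖ₑ := by
      rw [enorm_le_iff_norm_le]
      exact Complex.abs_im_le_norm (w - z)
    have h3 : ‖w - z‖ₑ ^ (-s) = ‖w - z‖ₑ ^ (-(s / 2)) * ‖w - z‖ₑ ^ (-(s / 2)) := by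
      rw [show -s = -(s / 2) * 2 by ring, ENNReal.rpow_mul, ENNReal.rpow_two, sq]
    rw [h3]
    simp only [ENNReal.rpow_neg]
    gcongr
  refine (lintegral_mono key).trans_lt ?_
  rw [lintegral_prod_mul (f := fun x : ℝ => ‖x - z.re‖ₑ ^ (-(s / 2)))
    (g := fun x : ℝ => ‖x - z.im‖ₑ ^ (-(s / 2))) (by fun_prop) (by fun_prop)]
  exact ENNReal.mul_lt_top
    (lintegral_enorm_sub_rpow_neg_gaussianReal_lt_top _ _ hv (by linarith) (by linarith))
    (lintegral_enorm_sub_rpow_neg_gaussianReal_lt_top _ _ hv (by linarith) (by linarith))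

/-- A Gaussian law gives intervals of length at most two a mass at least proportional to their
length. -/
theorem exists_ofReal_mul_le_gaussianReal_ball (a m : ℝ) {v : ℝ≥0} (hv : v ≠ 0) :
    ∃ c : ℝ, 0 < c ∧ ∀ r : ℝ, 0 < r → r ≤ 1 →
      ENNReal.ofReal (c * r) ≤ gaussianReal m v (Metric.ball a r) := by
  have hcont : Continuous (gaussianPDFReal m v) := by unfold gaussianPDFReal; fun_prop
  obtain ⟨x, -, hx⟩ := (isCompact_closedBall a 1).exists_isMinOn
    ⟨a, Metric.mem_closedBall_self zero_le_one⟩ hcont.continuousOn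
  -- The minimum of the density on the closed unit ball around `a`, times `2` because a ball of
  -- radius `r` has length `2 * r`.
  refine ⟨gaussianPDFReal m v x * 2, mul_pos (gaussianPDFReal_pos _ _ _ hv) two_pos,
    fun r _ hr => ?_⟩
  rw [gaussianReal_apply _ hv, mul_assoc, ENNReal.ofReal_mul (gaussianPDFReal_nonneg _ _ _),
    ← Real.volume_ball a r, ← setLIntegral_const]
  refine setLIntegral_mono (measurable_gaussianPDF _ _) fun y hy => ENNReal.ofReal_le_ofReal ?_
  exact hx (Metric.ball_subset_closedBall (Metric.ball_subset_ball hr hy))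

/-- The complex Gaussian law gives small disks a mass at least proportional to their area. -/
theorem exists_ofReal_mul_sq_le_stdComplexGaussian (z : ℂ) :
    ∃ c : ℝ, 0 < c ∧ ∀ r : ℝ, 0 < r → r ≤ 1 →
      ENNReal.ofReal (c * r ^ 2) ≤ stdComplexGaussian (Metric.ball z r) := by
  have hv : (1 / 2 : ℝ≥0) ≠ 0 := by norm_num
  obtain ⟨c₁, hc₁, h₁⟩ := exists_ofReal_mul_le_gaussianReal_ball z.re 0 hv
  obtain ⟨c₂, hc₂, h₂⟩ := exists_ofReal_mul_le_gaussianReal_ball z.im 0 hv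
  refine ⟨c₁ * c₂ / 4, by positivity, fun r hr hr1 => ?_⟩
  rw [stdComplexGaussian, MeasurableEquiv.map_apply]
  -- A square inside the disk turns its mass into a product of interval masses.
  have hsub : Metric.ball z.re (r / 2) ×ˢ Metric.ball z.im (r / 2) ⊆
      Complex.measurableEquivRealProd.symm ⁻¹' Metric.ball z r := by
    rintro ⟨x, y⟩ ⟨hx, hy⟩
    rw [Metric.mem_ball, Real.dist_eq] at hx hy
    rw [Set.mem_preimage, Metric.mem_ball, dist_eq_norm]
    refine (Complex.norm_le_abs_re_add_abs_im _).trans_lt ?_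
    have : |x - z.re| + |y - z.im| < r := by linarith
    exact this
  refine le_trans ?_ (measure_mono hsub)
  rw [Measure.prod_prod]
  refine le_trans (le_of_eq ?_) (mul_le_mul' (h₁ (r / 2) (by linarith) (by linarith))
    (h₂ (r / 2) (by linarith) (by linarith)))
  rw [← ENNReal.ofReal_mul (by positivity)]
  ring_nf

/-! ### Rician coefficients -/

theorem RicianLink.measurable_coeff (L : RicianLink) : Measurable L.coeff := by
  unfold RicianLink.coeff; fun_prop

/-- A Rician coefficient is a scaled translate of its non-line-of-sight component. -/
theorem RicianLink.exists_norm_coeff_eq (L : RicianLink) :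
    ∃ κ : ℝ, 0 < κ ∧ ∃ z : ℂ, ∀ w, ‖L.coeff w‖ = κ * ‖w - z‖ := by
  have hK : 0 < L.factor + 1 := by linarith [L.factor_nonneg]
  have ha : 0 < Real.sqrt (L.refLoss / L.dist ^ L.exponent) :=
    Real.sqrt_pos.2 (div_pos L.refLoss_pos (Real.rpow_pos_of_pos L.dist_pos _))
  have hσ : 0 < Real.sqrt (1 / (L.factor + 1)) := Real.sqrt_pos.2 (by positivity)
  refine ⟨_, mul_pos ha hσ,
    -((Real.sqrt (L.factor / (L.factor + 1)) : ℂ) * L.los / Real.sqrt (1 / (L.factor + 1))),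
    fun w => ?_⟩
  have hσ' : (Real.sqrt (1 / (L.factor + 1)) : ℂ) ≠ 0 := by exact_mod_cast hσ.ne'
  have hval : L.coeff w = ((Real.sqrt (L.refLoss / L.dist ^ L.exponent) *
      Real.sqrt (1 / (L.factor + 1)) : ℝ) : ℂ) *
        (w - -((Real.sqrt (L.factor / (L.factor + 1)) : ℂ) * L.los /
          Real.sqrt (1 / (L.factor + 1)))) := by
    rw [RicianLink.coeff, sub_neg_eq_add, Complex.ofReal_mul, mul_assoc, mul_add _ w,
      mul_div_cancel₀ _ hσ', add_comm]
  rw [hval, norm_mul, Complex.norm_real, Real.norm_of_nonneg (mul_pos ha hσ).le]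

theorem RicianLink.lintegral_enorm_coeff_rpow_neg_lt_top (L : RicianLink) {s : ℝ}
    (hs0 : 0 ≤ s) (hs : s < 2) : ∫⁻ w, ‖L.coeff w‖ₑ ^ (-s) ∂stdComplexGaussian < ∞ := by
  obtain ⟨κ, hκ, z, h⟩ := L.exists_norm_coeff_eq
  have h' : ∀ w, ‖L.coeff w‖ₑ ^ (-s) = ENNReal.ofReal κ ^ (-s) * ‖w - z‖ₑ ^ (-s) := fun w => by
    rw [← ENNReal.mul_rpow_of_ne_top (by simp) (by simp), ← ofReal_norm, h,
      ENNReal.ofReal_mul hκ.le, ofReal_norm]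
  simp_rw [h']
  rw [lintegral_const_mul _ (by fun_prop)]
  refine ENNReal.mul_lt_top ?_
    (lintegral_enorm_sub_rpow_neg_stdComplexGaussian_lt_top z hs0 hs)
  rw [ENNReal.ofReal_rpow_of_pos hκ]
  exact ENNReal.ofReal_lt_top

theorem RicianLink.exists_ofReal_mul_sq_le (L : RicianLink) :
    ∃ c : ℝ, 0 < c ∧ ∀ r : ℝ, 0 < r → r ≤ 1 →
      ENNReal.ofReal (c * r ^ 2) ≤ stdComplexGaussian {w | ‖L.coeff w‖ < r} := by
  obtain ⟨κ, hκ, z, h⟩ := L.exists_norm_coeff_eq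
  obtain ⟨c, hc, hb⟩ := exists_ofReal_mul_sq_le_stdComplexGaussian z
  -- Dividing by `max κ 1` instead of `κ` keeps the radius at most `1`, where the small-ball bound
  -- applies.
  have hmax : 0 < max κ 1 := lt_max_of_lt_left hκ
  refine ⟨c / max κ 1 ^ 2, by positivity, fun r hr hr1 => ?_⟩
  have hrm : r / max κ 1 ≤ 1 := (div_le_one hmax).2 (hr1.trans (le_max_right _ _))
  refine le_trans ?_ ((hb (r / max κ 1) (by positivity) hrm).trans (measure_mono fun w hw => ?_))
  · rw [div_pow]
    exact le_of_eq (by ring_nf)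
  · rw [Metric.mem_ball, dist_eq_norm, lt_div_iff₀ hmax] at hw
    rw [Set.mem_ofPred_eq, h, mul_comm]
    exact (mul_le_mul_of_nonneg_left (le_max_left _ _) (norm_nonneg _)).trans_lt hw


/-! ### Optimal phases and the coherent gain -/

/-- The largest modulus of the end-to-end channel over all phases. -/
noncomputable def coherentGain {M : ℕ} (c : Link M → ℂ) (χ : User) (b : ℝ) : ℝ :=
  (∑ m : Fin M, ‖c (.bsToElement m)‖ * ‖c (.elementToUser χ m)‖ * b) + ‖c (.direct χ)‖

theorem norm_endToEnd_le {M : ℕ} (c : Link M → ℂ) (χ : User) {b : ℝ} (hb : 0 ≤ b)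
    (φ : Fin M → ℝ) : ‖endToEnd c χ b φ‖ ≤ coherentGain c χ b := by
  refine (norm_add_le _ _).trans (add_le_add_left ((norm_sum_le _ _).trans (le_of_eq ?_)) _)
  refine Finset.sum_congr rfl fun m _ => ?_
  rw [mul_comm Complex.I, norm_mul, Complex.norm_exp_ofReal_mul_I, mul_one, norm_mul, norm_mul,
    Complex.norm_real, Real.norm_of_nonneg hb]

theorem exists_norm_endToEnd_eq {M : ℕ} (c : Link M → ℂ) (χ : User) {b : ℝ} (hb : 0 ≤ b) :
    ∃ ψ : Fin M → ℝ, (∀ m, ψ m ∈ Set.Ico 0 (2 * Real.pi)) ∧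
      ‖endToEnd c χ b ψ‖ = coherentGain c χ b := by
  -- These phases rotate each cascaded term to the argument of the direct link; reduction modulo
  -- `2π` brings them into the admissible range.
  set θ : Fin M → ℝ := fun m => (c (.direct χ)).arg -
    (c (.bsToElement m)).arg - (c (.elementToUser χ m)).arg with hθ
  refine ⟨fun m => toIcoMod Real.two_pi_pos 0 (θ m), fun m => ?_, ?_⟩
  · simpa using toIcoMod_mem_Ico Real.two_pi_pos 0 (θ m)
  have hexp : ∀ m, Complex.exp (Complex.I * (toIcoMod Real.two_pi_pos 0 (θ m) : ℝ)) =
      Complex.exp ((c (.direct χ)).arg * Complex.I) *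
        (Complex.exp (-((c (.bsToElement m)).arg * Complex.I)) *
          Complex.exp (-((c (.elementToUser χ m)).arg * Complex.I))) := fun m => by
    rw [toIcoMod, ← Complex.exp_add, ← Complex.exp_add]
    refine Complex.exp_eq_exp_iff_exists_int.2 ⟨-toIcoDiv Real.two_pi_pos 0 (θ m), ?_⟩
    simp only [hθ]
    push_cast [zsmul_eq_mul]
    ring
  have hunit : ∀ z : ℂ, z * Complex.exp (-(z.arg * Complex.I)) = ‖z‖ := fun z => by
    nth_rw 1 [← Complex.norm_mul_exp_arg_mul_I z]
    rw [mul_assoc, ← Complex.exp_add, add_neg_cancel, Complex.exp_zero, mul_one]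
  have hsum : endToEnd c χ b (fun m => toIcoMod Real.two_pi_pos 0 (θ m)) =
      (coherentGain c χ b : ℂ) * Complex.exp ((c (.direct χ)).arg * Complex.I) := by
    rw [endToEnd, coherentGain]
    push_cast
    rw [add_mul, Complex.norm_mul_exp_arg_mul_I, Finset.sum_mul]
    congr 1
    refine Finset.sum_congr rfl fun m _ => ?_
    rw [hexp, ← hunit, ← hunit]
    ring
  rw [hsum, norm_mul, Complex.norm_exp_ofReal_mul_I, mul_one, Complex.norm_real,
    Real.norm_of_nonneg]
  exact add_nonneg (Finset.sum_nonneg fun m _ => by positivity) (norm_nonneg _)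

theorem IsPrimaryConfigured.norm_endToEnd_eq {M : ℕ} {c : Link M → ℂ} {b : User → ℝ} {p : User}
    {φ : User → Fin M → ℝ} {ν : Fin M → Fin 2} (h : IsPrimaryConfigured c b p φ ν)
    (hb : 0 ≤ b p) : ‖endToEnd c p (b p) (φ p)‖ = coherentGain c p (b p) := by
  refine (norm_endToEnd_le c p hb _).antisymm ?_
  obtain ⟨ψ, hψ, hψe⟩ := exists_norm_endToEnd_eq c p hb
  rw [← hψe]
  exact (sq_le_sq₀ (norm_nonneg _) (norm_nonneg _)).1 (h.primary_max ψ hψ)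

/-! ### Outage events as thresholds on the received power -/

theorem logb_two_one_add_lt_iff {x R : ℝ} (hx : 0 ≤ x) :
    Real.logb 2 (1 + x) < R ↔ x < 2 ^ R - 1 := by
  rw [Real.logb_lt_iff_lt_rpow one_lt_two (by linarith), lt_sub_iff_add_lt']

theorem two_rpow_sub_one_pos {R : ℝ} (hR : 0 < R) : 0 < (2 : ℝ) ^ R - 1 :=
  sub_pos.2 (Real.one_lt_rpow one_lt_two hR)

theorem Access.omaOutage_iff (A : Access) (χ : User) :
    ∃ τ : ℝ, 0 < τ ∧ ∀ (P : ℝ) (H : ℂ), 0 < P → (A.omaOutage χ P H ↔ P * ‖H‖ ^ 2 < τ) := by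
  have hc := A.coef_pos χ
  have hn := A.noise_pos
  have hR := two_rpow_sub_one_pos (R := 2 * A.target χ) (by linarith [A.target_pos χ])
  refine ⟨(2 ^ (2 * A.target χ) - 1) * (A.noise / 2) / A.coef χ ^ 2, by positivity,
    fun P H hP => ?_⟩
  have h : A.omaOutage χ P H ↔
      Real.logb 2 (1 + P * A.coef χ ^ 2 * ‖H‖ ^ 2 / (A.noise / 2)) < 2 * A.target χ := by
    rw [Access.omaOutage, Access.omaRate]
    constructor <;> intro h <;> linarith
  rw [h, logb_two_one_add_lt_iff (by positivity), div_lt_iff₀ (by positivity),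
    lt_div_iff₀ (by positivity)]
  ring_nf

/-- As the power grows, the signal-to-interference ratio saturates at `A.coef s.other ^ 2 / A.coef s
^ 2`. The hypothesis puts this ceiling above the required ratio, so the denominator of the threshold
is positive; otherwise outage would occur at every power. -/
theorem Access.nomaInterferedRate_lt_iff (A : Access) (s : User)
    (h : ((2 : ℝ) ^ A.target s.other - 1) * A.coef s ^ 2 < A.coef s.other ^ 2) :
    ∃ τ : ℝ, 0 < τ ∧ ∀ (P : ℝ) (H : ℂ), 0 < P →
      (A.nomaInterferedRate s P H < A.target s.other ↔ P * ‖H‖ ^ 2 < τ) := by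
  have hc := A.coef_pos s
  have hn := A.noise_pos
  have hR := two_rpow_sub_one_pos (A.target_pos s.other)
  have hd := sub_pos.2 h
  refine ⟨(2 ^ A.target s.other - 1) * A.noise /
    (A.coef s.other ^ 2 - (2 ^ A.target s.other - 1) * A.coef s ^ 2), by positivity,
    fun P H hP => ?_⟩
  rw [Access.nomaInterferedRate, logb_two_one_add_lt_iff (by positivity),
    div_lt_iff₀ (by positivity), lt_div_iff₀ hd]
  constructor <;> intro h <;> linarith

theorem Access.nomaOwnRate_lt_iff (A : Access) (s : User) :
    ∃ τ : ℝ, 0 < τ ∧ ∀ (P : ℝ) (H : ℂ), 0 < P →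
      (A.nomaOwnRate s P H < A.target s ↔ P * ‖H‖ ^ 2 < τ) := by
  have hc := A.coef_pos s
  have hn := A.noise_pos
  have hR := two_rpow_sub_one_pos (A.target_pos s)
  refine ⟨(2 ^ A.target s - 1) * A.noise / A.coef s ^ 2, by positivity, fun P H hP => ?_⟩
  rw [Access.nomaOwnRate, logb_two_one_add_lt_iff (by positivity), div_lt_iff₀ hn,
    lt_div_iff₀ (by positivity)]
  ring_nf

/-- For the SIC user, the union of two threshold events is again one, at the larger threshold. -/
theorem Access.nomaOutage_iff (A : Access) (s χ : User)
    (h : ((2 : ℝ) ^ A.target s.other - 1) * A.coef s ^ 2 < A.coef s.other ^ 2) :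
    ∃ τ : ℝ, 0 < τ ∧ ∀ (P : ℝ) (H : ℂ), 0 < P → (A.nomaOutage s χ P H ↔ P * ‖H‖ ^ 2 < τ) := by
  obtain ⟨τ₁, h₁, e₁⟩ := A.nomaInterferedRate_lt_iff s h
  obtain ⟨τ₂, h₂, e₂⟩ := A.nomaOwnRate_lt_iff s
  have hsic : ∃ τ : ℝ, 0 < τ ∧ ∀ (P : ℝ) (H : ℂ), 0 < P →
      ((A.nomaInterferedRate s P H < A.target s.other ∨ A.nomaOwnRate s P H < A.target s) ↔
        P * ‖H‖ ^ 2 < τ) :=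
    ⟨max τ₁ τ₂, lt_max_of_lt_left h₁, fun P H hP => by rw [e₁ P H hP, e₂ P H hP, lt_max_iff]⟩
  cases s <;> cases χ
  · exact hsic
  · exact ⟨τ₁, h₁, e₁⟩
  · exact ⟨τ₁, h₁, e₁⟩
  · exact hsic

/-! ### From power bounds to the diversity order -/

/-- A function squeezed between powers of exponent `-d` and arbitrarily close to `-d`, up to
constants, has diversity order `d`. -/
theorem hasDiversityOrder_of_bounds {f : ℝ → ℝ} {d : ℝ}
    (hlow : ∃ c : ℝ, 0 < c ∧ ∀ᶠ P in atTop, c * P ^ (-d) ≤ f P)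
    (hup : ∀ a < d, ∃ a' : ℝ, a < a' ∧ ∃ C : ℝ, 0 < C ∧ ∀ᶠ P in atTop, f P ≤ C * P ^ (-a')) :
    HasDiversityOrder f d := by
  obtain ⟨c, hc, hlow⟩ := hlow
  have hlim : ∀ k e : ℝ, Tendsto (fun P : ℝ => e - k / Real.log P) atTop (𝓝 e) := fun k e => by
    simpa using tendsto_const_nhds.sub (Real.tendsto_log_atTop.const_div_atTop k)
  have hpow : ∀ k e P : ℝ, 0 < k → 1 < P →
      -(Real.log (k * P ^ (-e)) / Real.log P) = e - Real.log k / Real.log P := by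
    intro k e P hk hP
    have hlog := (Real.log_pos hP).ne'
    rw [Real.log_mul hk.ne' (Real.rpow_pos_of_pos (by linarith) _).ne',
      Real.log_rpow (by linarith)]
    field_simp
    ring
  refine tendsto_order.2 ⟨fun a ha => ?_, fun a ha => ?_⟩
  · obtain ⟨a', ha', C, hC, hup⟩ := hup a ha
    filter_upwards [hlow, hup, eventually_gt_atTop 1,
      (tendsto_order.1 (hlim (Real.log C) a')).1 a ha'] with P h1 h2 hP h3
    -- Monotonicity of the logarithm needs `f P` positive, so the lower bound enters here too.
    have hf : 0 < f P := lt_of_lt_of_le (mul_pos hc (Real.rpow_pos_of_pos (by linarith) _)) h1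
    rw [← hpow C a' P hC hP] at h3
    refine h3.trans_le (neg_le_neg ?_)
    exact div_le_div_of_nonneg_right (Real.log_le_log hf h2) (Real.log_pos hP).le
  · filter_upwards [hlow, eventually_gt_atTop 1,
      (tendsto_order.1 (hlim (Real.log c) d)).2 a ha] with P h1 hP h3
    rw [← hpow c d P hc hP] at h3
    refine lt_of_le_of_lt (neg_le_neg ?_) h3
    exact div_le_div_of_nonneg_right (Real.log_le_log
      (mul_pos hc (Real.rpow_pos_of_pos (by linarith) _)) h1) (Real.log_pos hP).le


/-! ### Probability that the coherent gain is small -/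

/-- The links seen by user `χ`: the two hops of the cascaded paths and the direct link. -/
def userLink {M : ℕ} (χ : User) : Fin M ⊕ Option (Fin M) → Link M
  | .inl m => .bsToElement m
  | .inr (some m) => .elementToUser χ m
  | .inr none => .direct χ

theorem userLink_injective {M : ℕ} (χ : User) : Function.Injective (userLink (M := M) χ) := by
  rintro (i | _ | i) (j | _ | j) h <;> simp_all [userLink]

section

variable {M : ℕ} {Ω : Type*} [MeasurableSpace Ω] {μ : Measure Ω}
  {L : Link M → RicianLink} {W : Link M → Ω → ℂ}

/-- The coherent gain falls below a small `ε` with probability at least of order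
`ε ^ (2 * (M + 1))`. -/
theorem exists_le_measureReal_coherentGain_lt [IsProbabilityMeasure μ]
    (hW_law : ∀ l, HasLaw (W l) stdComplexGaussian μ) (hW_indep : iIndepFun W μ)
    (p : User) {b : ℝ} (hb : 0 ≤ b) :
    ∃ c : ℝ, 0 < c ∧ ∀ ε : ℝ, 0 < ε → ε ≤ 1 →
      c * (ε ^ 2) ^ (M + 1) ≤
        μ.real {ω | coherentGain (fun l => (L l).coeff (W l ω)) p b < ε} := by
  choose c hc hcr using fun l => (L l).exists_ofReal_mul_sq_le
  have hN : (0 : ℝ) < M * b + 1 := by positivity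
  refine ⟨(∏ m : Fin M, c (.bsToElement m)) * ((c (.direct p) * (1 / (M * b + 1)) ^ 2) *
    ∏ m : Fin M, c (.elementToUser p m) * (1 / (M * b + 1)) ^ 2),
    mul_pos (Finset.prod_pos fun m _ => hc _) (mul_pos (mul_pos (hc _) (by positivity))
      (Finset.prod_pos fun m _ => mul_pos (hc _) (by positivity))), fun ε hε hε1 => ?_⟩
  -- Chosen so that `M * (1 * η * b) + η = ε`.
  set η : ℝ := ε / (M * b + 1) with hη
  have hη0 : 0 < η := by positivity
  have hη1 : η ≤ 1 := (div_le_one hN).2 (hε1.trans (by nlinarith [Nat.cast_nonneg (α := ℝ) M]))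
  -- First hops are only kept below `1`; the `M + 1` remaining links carry the small radius and
  -- hence the exponent.
  set r : Fin M ⊕ Option (Fin M) → ℝ := Sum.elim (fun _ => 1) (fun _ => η) with hr
  have hr0 : ∀ i, 0 < r i := by rintro (i | i) <;> simp [hr, hη0]
  have hr1 : ∀ i, r i ≤ 1 := by rintro (i | i) <;> simp [hr, hη1]
  have hmeas : ∀ i, MeasurableSet {w | ‖(L (userLink p i)).coeff w‖ < r i} := fun i =>
    measurableSet_lt (RicianLink.measurable_coeff _).norm measurable_const
  have hind := (hW_indep.precomp (userLink_injective p)).measure_inter_preimage_eq_mul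
    Finset.univ (sets := fun i => {w | ‖(L (userLink p i)).coeff w‖ < r i}) fun i _ => hmeas i
  have hsub : (⋂ i ∈ Finset.univ, W (userLink p i) ⁻¹' {w | ‖(L (userLink p i)).coeff w‖ < r i}) ⊆
      {ω | coherentGain (fun l => (L l).coeff (W l ω)) p b < ε} := by
    intro ω hω
    simp only [Finset.mem_univ, Set.iInter_true, Set.mem_iInter, Set.mem_preimage,
      Set.mem_ofPred_eq] at hω
    have hg : ∀ m : Fin M, _ < (1 : ℝ) := fun m => hω (.inl m)
    have hh : ∀ m : Fin M, _ < η := fun m => hω (.inr (some m))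
    have hd : _ < η := hω (.inr none)
    calc coherentGain (fun l => (L l).coeff (W l ω)) p b
        < (∑ _m : Fin M, 1 * η * b) + η := by
          refine add_lt_add_of_le_of_lt (Finset.sum_le_sum fun m _ => ?_) hd
          exact mul_le_mul_of_nonneg_right
            (mul_le_mul (hg m).le (hh m).le (norm_nonneg _) zero_le_one) hb
      _ = ε := by
          rw [Finset.sum_const, Finset.card_univ, Fintype.card_fin, nsmul_eq_mul, hη]
          field_simp
  have hlow : ENNReal.ofReal (∏ i, c (userLink p i) * r i ^ 2) ≤
      μ {ω | coherentGain (fun l => (L l).coeff (W l ω)) p b < ε} := by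
    refine le_trans ?_ (hind.symm.le.trans (measure_mono hsub))
    rw [ENNReal.ofReal_prod_of_nonneg fun i _ => mul_nonneg (hc _).le (sq_nonneg _)]
    refine Finset.prod_le_prod' fun i _ => ?_
    rw [← Measure.map_apply_of_aemeasurable (hW_law _).aemeasurable (hmeas i), (hW_law _).map_eq]
    exact hcr _ _ (hr0 i) (hr1 i)
  refine le_trans (le_of_eq ?_) ((ENNReal.ofReal_le_iff_le_toReal (measure_ne_top _ _)).1 hlow)
  rw [Fintype.prod_sum_type, Fintype.prod_option]
  simp only [hr, hη, userLink, Sum.elim_inl, Sum.elim_inr, Finset.prod_mul_distrib,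
    Finset.prod_const, Finset.card_univ, Fintype.card_fin, div_pow, one_pow, mul_one]
  ring

/-- For every `s < 2`, the coherent gain falls below `ε` with probability at most of order
`ε ^ (s * (M + 1))`. -/
theorem exists_measureReal_coherentGain_lt_le
    (hW_law : ∀ l, HasLaw (W l) stdComplexGaussian μ) (hW_indep : iIndepFun W μ)
    (p : User) {b : ℝ} (hb : 0 < b) {s : ℝ} (hs0 : 0 ≤ s) (hs : s < 2) :
    ∃ C : ℝ, 0 < C ∧ ∀ ε : ℝ, 0 < ε →
      μ.real {ω | coherentGain (fun l => (L l).coeff (W l ω)) p b < ε} ≤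
        C * (ε ^ s) ^ (M + 1) := by
  -- The `1` serves the direct link, the `1 / b` the cascaded products, which enter the gain with
  -- weight `b`.
  set N : ℝ := max 1 (1 / b) with hN
  have hN0 : 0 < N := lt_max_of_lt_left one_pos
  set f : Fin M ⊕ Option (Fin M) → ℂ → ℝ≥0∞ :=
    fun i w => ‖(L (userLink p i)).coeff w‖ₑ ^ (-s) with hf
  have hfm : ∀ i, Measurable (f i) := fun i => (RicianLink.measurable_coeff _).enorm.pow_const _
  have hWm := fun i => (hW_law (userLink p i)).aemeasurable
  -- The `W l` are only a.e. measurable, so the product formula is applied to measurable versions.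
  have hmk : iIndepFun (fun i => (hWm i).mk) μ :=
    (iIndepFun_congr fun i => (hWm i).ae_eq_mk).1 (hW_indep.precomp (userLink_injective p))
  have hprod : ∫⁻ ω, ∏ i, f i (W (userLink p i) ω) ∂μ =
      ∏ i, ∫⁻ w, f i w ∂stdComplexGaussian := by
    have h1 : ∫⁻ ω, ∏ i, f i (W (userLink p i) ω) ∂μ = ∫⁻ ω, ∏ i, f i ((hWm i).mk _ ω) ∂μ := by
      refine lintegral_congr_ae ?_
      filter_upwards [ae_all_iff.2 fun i => (hWm i).ae_eq_mk] with ω hω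
      exact Finset.prod_congr rfl fun i _ => by rw [hω i]
    rw [h1, lintegral_prod_eq_prod_lintegral_of_indepFun Finset.univ
      (fun i ω => f i ((hWm i).mk _ ω)) (hmk.comp f hfm)
      fun i => (hfm i).comp (hWm i).measurable_mk]
    refine Finset.prod_congr rfl fun i _ => ?_
    rw [← (hW_law (userLink p i)).lintegral_comp (hfm i).aemeasurable]
    refine lintegral_congr_ae ?_
    filter_upwards [(hWm i).ae_eq_mk] with ω hω
    rw [hω]
  set I : ℝ≥0∞ := ∏ i, ∫⁻ w, f i w ∂stdComplexGaussian
  have hI_top : I ≠ ∞ := ENNReal.prod_ne_top fun i _ =>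
    ((L (userLink p i)).lintegral_enorm_coeff_rpow_neg_lt_top hs0 hs).ne
  -- The `+ 1` makes the constant positive without showing `I ≠ 0`.
  refine ⟨(N ^ s) ^ (M + 1) * (I.toReal + 1), by positivity, fun ε hε => ?_⟩
  set δ : ℝ := N * ε with hδ
  have hδ0 : 0 < δ := by positivity
  set K : ℝ≥0∞ := (ENNReal.ofReal δ ^ (-s)) ^ (M + 1) with hK
  have hsub : {ω | coherentGain (fun l => (L l).coeff (W l ω)) p b < ε} ⊆
      {ω | K ≤ ∏ i, f i (W (userLink p i) ω)} := by
    intro ω hω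
    rw [Set.mem_ofPred_eq, coherentGain] at hω
    have hnn : ∀ m : Fin M, 0 ≤ ‖(L (.bsToElement m)).coeff (W (.bsToElement m) ω)‖ *
        ‖(L (.elementToUser p m)).coeff (W (.elementToUser p m) ω)‖ * b := fun m => by positivity
    have hd : ‖(L (.direct p)).coeff (W (.direct p) ω)‖ ≤ δ := by
      have := Finset.sum_nonneg fun m (_ : m ∈ Finset.univ) => hnn m
      have h1 : ε ≤ δ := le_mul_of_one_le_left hε.le (le_max_left _ _)
      linarith
    have hm : ∀ m : Fin M, ‖(L (.bsToElement m)).coeff (W (.bsToElement m) ω)‖ *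
        ‖(L (.elementToUser p m)).coeff (W (.elementToUser p m) ω)‖ ≤ δ := fun m => by
      have h1 := Finset.single_le_sum (fun m _ => hnn m) (Finset.mem_univ m)
      have h2 := norm_nonneg ((L (.direct p)).coeff (W (.direct p) ω))
      have h3 : 1 / b * ε ≤ δ := mul_le_mul_of_nonneg_right (le_max_right _ _) hε.le
      refine le_trans ?_ h3
      rw [one_div_mul_eq_div, le_div_iff₀ hb]
      linarith
    -- Pairing the two hops of each element leaves `M + 1` factors, each at least `δ ^ (-s)`.
    rw [Set.mem_ofPred_eq, Fintype.prod_sum_type, Fintype.prod_option, mul_left_comm,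
      ← Finset.prod_mul_distrib, hK, pow_succ']
    refine mul_le_mul' ?_ ?_
    · simp only [hf, ENNReal.rpow_neg, userLink]
      gcongr
      rw [← ofReal_norm]
      exact ENNReal.ofReal_le_ofReal hd
    · refine le_of_eq_of_le (by rw [Finset.prod_const, Finset.card_univ, Fintype.card_fin])
        (Finset.prod_le_prod' (f := fun _ => ENNReal.ofReal δ ^ (-s)) fun m _ => ?_)
      simp only [hf, userLink]
      rw [← ENNReal.mul_rpow_of_ne_top (by simp) (by simp), ENNReal.rpow_neg, ENNReal.rpow_neg]
      gcongr
      rw [← ofReal_norm, ← ofReal_norm, ← ENNReal.ofReal_mul (norm_nonneg _)]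
      exact ENNReal.ofReal_le_ofReal (hm m)
  have hKreal : K = ENNReal.ofReal ((δ ^ (-s)) ^ (M + 1)) := by
    rw [hK, ENNReal.ofReal_rpow_of_pos hδ0, ENNReal.ofReal_pow (by positivity)]
  have hmarkov : K * μ {ω | coherentGain (fun l => (L l).coeff (W l ω)) p b < ε} ≤ I := by
    rw [← hprod]
    refine le_trans (mul_le_mul_right (measure_mono hsub) _) (mul_meas_ge_le_lintegral₀ ?_ K)
    exact Finset.aemeasurable_fun_prod _ fun i _ => (hfm i).comp_aemeasurable (hWm i)
  have hreal := ENNReal.toReal_mono hI_top hmarkov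
  rw [ENNReal.toReal_mul, hKreal, ENNReal.toReal_ofReal (by positivity), Real.rpow_neg hδ0.le,
    inv_pow, inv_mul_le_iff₀ (by positivity)] at hreal
  refine hreal.trans ?_
  rw [hδ, Real.mul_rpow hN0.le hε.le, mul_pow, mul_right_comm]
  gcongr
  linarith

/-! ### Diversity order of threshold events -/

/-- An event which for positive `P` amounts to `P * ‖H‖ ^ 2 < τ` for the primary channel `H` has
diversity order `M + 1`. -/
theorem hasDiversityOrder_of_threshold [IsProbabilityMeasure μ]
    (hW_law : ∀ l, HasLaw (W l) stdComplexGaussian μ) (hW_indep : iIndepFun W μ)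
    {b : User → ℝ} {p : User} (hbp : 0 < b p)
    {φ : Ω → User → Fin M → ℝ} {ν : Ω → Fin M → Fin 2}
    (hφ : ∀ᵐ ω ∂μ, IsPrimaryConfigured (fun l => (L l).coeff (W l ω)) b p (φ ω) (ν ω))
    {outage : ℝ → ℂ → Prop}
    (hout : ∃ τ : ℝ, 0 < τ ∧ ∀ (P : ℝ) (H : ℂ), 0 < P → (outage P H ↔ P * ‖H‖ ^ 2 < τ)) :
    HasDiversityOrder (fun P => μ.real {ω | outage P
      (endToEnd (fun l => (L l).coeff (W l ω)) p (b p) (φ ω p))}) (M + 1) := by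
  obtain ⟨τ, hτ, hout⟩ := hout
  have hgain : ∀ c : Link M → ℂ, 0 ≤ coherentGain c p (b p) := fun c =>
    add_nonneg (Finset.sum_nonneg fun m _ => by positivity) (norm_nonneg _)
  have heq : ∀ P : ℝ, 0 < P → μ.real {ω | outage P
      (endToEnd (fun l => (L l).coeff (W l ω)) p (b p) (φ ω p))} =
      μ.real {ω | coherentGain (fun l => (L l).coeff (W l ω)) p (b p) < Real.sqrt (τ / P)} := by
    intro P hP
    -- Almost everywhere equality of the events suffices, so the phases need not be measurable in
    -- `ω`.
    refine measureReal_congr ?_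
    filter_upwards [hφ] with ω hω
    refine propext ?_
    change outage P _ ↔ _ < _
    rw [hout P _ hP, hω.norm_endToEnd_eq hbp.le, Real.lt_sqrt (hgain _), lt_div_iff₀ hP, mul_comm]
  have hpow : ∀ P e : ℝ, 0 < P →
      (Real.sqrt (τ / P) ^ e) ^ (M + 1) = τ ^ (e / 2 * (M + 1)) * P ^ (-(e / 2 * (M + 1))) := by
    intro P e hP
    rw [Real.sqrt_eq_rpow, ← Real.rpow_mul (by positivity), ← Real.rpow_natCast,
      ← Real.rpow_mul (by positivity), Real.div_rpow hτ.le hP.le, Real.rpow_neg hP.le,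
      div_eq_mul_inv]
    push_cast
    ring_nf
  refine hasDiversityOrder_of_bounds ?_ fun a ha => ?_
  · obtain ⟨c, hc, h⟩ := exists_le_measureReal_coherentGain_lt (L := L) hW_law hW_indep p hbp.le
    refine ⟨c * τ ^ ((2 : ℝ) / 2 * (M + 1)), by positivity, ?_⟩
    filter_upwards [eventually_gt_atTop 0, eventually_ge_atTop τ] with P hP hPτ
    rw [heq P hP]
    refine le_trans (le_of_eq ?_) (h (Real.sqrt (τ / P)) (Real.sqrt_pos.2 (by positivity))
      (Real.sqrt_le_one.2 ((div_le_one hP).2 hPτ)))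
    rw [← Real.rpow_two, hpow P 2 hP, mul_assoc]
    norm_num
  · have hM : (0 : ℝ) < M + 1 := by positivity
    -- Here `s` is half the moment order: `s < 1` keeps the moments finite, `s > a / (M + 1)` makes
    -- the decay exponent exceed `a`, and the maximum with `0` covers negative `a`.
    obtain ⟨s, hs1, hs⟩ := exists_between (max_lt ((div_lt_one hM).2 ha) (zero_lt_one (α := ℝ)))
    obtain ⟨has, hs0⟩ := max_lt_iff.1 hs1
    obtain ⟨C, hC, h⟩ := exists_measureReal_coherentGain_lt_le (L := L) hW_law hW_indep p hbp
      (s := 2 * s) (by linarith) (by linarith)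
    refine ⟨2 * s / 2 * (M + 1), ?_, C * τ ^ (2 * s / 2 * (M + 1)), by positivity, ?_⟩
    · rwa [mul_div_cancel_left₀ _ two_ne_zero, ← div_lt_iff₀ hM]
    filter_upwards [eventually_gt_atTop 0] with P hP
    rw [heq P hP]
    refine (h _ (Real.sqrt_pos.2 (by positivity))).trans (le_of_eq ?_)
    rw [hpow P _ hP, mul_assoc]

end

end StarRis

theorem corollary1 {M : ℕ} {Ω : Type*} [MeasurableSpace Ω] (μ : Measure Ω) [IsProbabilityMeasure μ]
    -- Rician links with i.i.d. complex Gaussian non-line-of-sight components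
    (L : StarRis.Link M → StarRis.RicianLink) (W : StarRis.Link M → Ω → ℂ)
    (hW_law : ∀ l, HasLaw (W l) StarRis.stdComplexGaussian μ) (hW_indep : iIndepFun W μ)
    -- common amplitudes of the transmission and reflection coefficients, and the primary user
    (b : StarRis.User → ℝ) (p : StarRis.User) (hbR : b .R ∈ Set.Icc 0 1)
    (hbT : b .T = Real.sqrt (1 - b .R ^ 2)) (hbp : 0 < b p)
    -- phases whose primary part maximizes the primary gain; the auxiliary bits are arbitrary
    (φ : Ω → StarRis.User → Fin M → ℝ) (ν : Ω → Fin M → Fin 2)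
    (hφ : ∀ᵐ ω ∂μ, StarRis.IsPrimaryConfigured (fun l => (L l).coeff (W l ω)) b p (φ ω) (ν ω))
    (A : StarRis.Access) :
    StarRis.HasDiversityOrder
      (fun P => μ.real {ω | A.omaOutage p P
        (StarRis.endToEnd (fun l => (L l).coeff (W l ω)) p (b p) (φ ω p))}) (M + 1) ∧
    ∀ s : StarRis.User,
      -- the message of the non-SIC user is decodable when the noise is negligible
      ((2 : ℝ) ^ A.target s.other - 1) * A.coef s ^ 2 < A.coef s.other ^ 2 →
      StarRis.HasDiversityOrder
        (fun P => μ.real {ω | A.nomaOutage s p P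
          (StarRis.endToEnd (fun l => (L l).coeff (W l ω)) p (b p) (φ ω p))}) (M + 1) := by
  exact ⟨StarRis.hasDiversityOrder_of_threshold hW_law hW_indep hbp hφ (A.omaOutage_iff p),
    fun s h => StarRis.hasDiversityOrder_of_threshold hW_law hW_indep hbp hφ
      (A.nomaOutage_iff s p h)⟩
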